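/- **Setting.** Functions "piecewise continuous" on $[0,\infty)$ have finitely many discontinuities on each bounded interval and finite one-sided limits everywhere. A function of $(t,\hat x)$ is called *regular on $E$* if it is piecewise continuous in $t\ge 0$ for each fixed $\hat x\in E$ and locally Lipschitz in $\hat x\in E$, uniformly for $t$ in bounded intervals. Norms are Euclidean. Consider the system $\dot x=f(x)+g(x)u+g_d(x)d(t)$, $y=c(x)+c_d(x)v(t)$ with state in an open set $\mathcal X\subseteq\mathbb R^n$ and input $u\in\mathcal U=\mathbb R^m$, where $f,g,g_d,c,c_d$ are locally Lipschitz and the disturbances $d,v$ are piecewise continuous with $\|d(t)\|\le\bar d$, $\|v(t)\|\le\bar v$. Let the observer be $\dot{\hat x}=p(\hat x,y)+q(\hat x,y)u$ with $p,q$ locally Lipschitz on $\mathcal X\times\mathbb R^{n_y}$, and let $E\subseteq\mathcal X$ be the set of state estimates under consideration (for instance $E=\mathcal S$ or $E=\mathcal X$). For an estimate-feedback controller $u=\pi(t,\hat x)$, a closed-loop solution is a pair $(x,\hat x)$ that solves the two equations on an interval $[0,T)$ with $x(t)\in\mathcal X$ and $\hat x(t)\in E$. Let $\mathcal S=\{x\in\mathcal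 X:h(x)\ge0\}$, where $h:\mathcal X\to\mathbb R$ is $C^1$ and is a tunable robust control barrier function: with a class $\mathcal K$ function $\alpha$ and a continuous nonincreasing $\kappa$ on $[0,\infty)$, $\kappa(0)=1$, $$\sup_{u\in\mathbb R^m}\; L_fh(x)+L_gh(x)u+\alpha(h(x))\;\ge\;\kappa(h(x))\,\|L_{g_d}h(x)\|\,\bar d\qquad\forall x\in\mathcal S .$$ Let $\alpha$ and $\kappa$ be extended to negative arguments so that $\alpha$ stays nondecreasing and $\kappa$ nonincreasing. Let sets $\mathcal D(\hat x_0)$ and $\mathcal P(t,\hat x)$ be given for $\hat x_0,\hat x\in E$, $t\ge0$, and let $\bar w\ge\bar d$ (for instance $\bar w=\max(\bar d,\bar v)$). Suppose: 1. $a$ is a real function, regular on $E$, and for all $t\ge0$, $\hat x\in E$, $x\in\mathcal P(t,\hat x)$: $\;a(t,\hat x)\le L_fh(x)-\kappa(h(x))\|L_{g_d}h(x)\|\bar w+\alpha(h(x))$. 2. $b_i^-,b_i^+$ ($i=1,\dots,m$) are real functions, regular on $E$, and for all $t\ge0$, $\hat x\in E$: $b_i^-(t,\hat x)\le[L_gh(x)]_i\le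 b_i^+(t,\hat x)$ for all $x\in\mathcal P(t,\hat x)$; $\operatorname{sign} b_i^-(t,\hat x)=\operatorname{sign} b_i^+(t,\hat x)$; and $\mathcal P(t,\hat x)$ contains a point $x$ with $L_gh(x)\ne0$. Moreover no $b_i^\pm$ tends to $0$ through nonzero values: for every $T$ and $\hat x_0\in E$ there are $\varepsilon>0$ and a neighbourhood $V$ of $\hat x_0$ in $E$ such that for all $t\in[0,T]$, $\hat x\in V$, each of the numbers $b_i^\pm(t,\hat x)$ is $0$ or has absolute value at least $\varepsilon$. 3. $\pi_{\rm des}$ is an $\mathbb R^m$-valued desired controller, regular on $E$. **Theorem.** Consider the quadratic program $$\pi(t,\hat x)=\operatorname*{argmin}_{u\in\mathbb R^m}\|u-\pi_{\rm des}(t,\hat x)\|^2\quad\text{s.t.}\quad a(t,\hat x)+\sum_{i=1}^m\min\{b_i^-(t,\hat x)u_i,\;b_i^+(t,\hat x)u_i\}\ge0 .$$ Suppose the observer, in closed loop with a controller given by this program, is a bounded-error observer: $\mathcal D(\hat x_0)$ and $\mathcal P(t,\hat x)$ are bounded subsets of $\mathcal X$, and every closed-loop solution with $x(0)\in\mathcal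 D(\hat x(0))$ satisfies $x(t)\in\mathcal P(t,\hat x(t))$ for as long as it exists. Then for every $t\ge0$ and $\hat x\in E$ the program has exactly one solution; the resulting controller $\pi$ is regular on $E$ (piecewise continuous in $t$, locally Lipschitz in $\hat x$ uniformly for $t$ in bounded intervals); and it renders the system safe: every closed-loop solution with $\hat x(0)\in\{\hat x\in E:\mathcal P(0,\hat x)\subseteq\mathcal S\}$ and $x(0)\in\mathcal D(\hat x(0))$ satisfies $x(t)\in\mathcal S$ for as long as it exists. -/

import Mathlib

open Set Filter Topology MeasureTheory
open scoped NNReal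

noncomputable section

/-- `ℝᵏ` with the Euclidean norm. -/
abbrev Vec (k : ℕ) := EuclideanSpace ℝ (Fin k)

/-! ### Regularity in time and in the state -/

/-- Piecewise continuity on `[0, ∞)`: finitely many discontinuities in each bounded interval,
and finite one-sided limits everywhere. -/
def PiecewiseContinuous {F : Type*} [TopologicalSpace F] (f : ℝ → F) : Prop :=
  (∀ T : ℝ, ∃ D : Finset ℝ, ∀ t ∈ Icc 0 T, t ∉ D → ContinuousWithinAt f (Ici 0) t) ∧
  (∀ t : ℝ, 0 ≤ t → ∃ l : F, Tendsto f (𝓝[>] t) (𝓝 l)) ∧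
  (∀ t : ℝ, 0 < t → ∃ l : F, Tendsto f (𝓝[<] t) (𝓝 l))

/-- `f t z` is locally Lipschitz in `z ∈ E`, uniformly for `t` in bounded intervals `[0, T]`. -/
def LipschitzInState {n : ℕ} {F : Type*} [PseudoEMetricSpace F]
    (E : Set (Vec n)) (f : ℝ → Vec n → F) : Prop :=
  ∀ T : ℝ, ∀ z₀ ∈ E, ∃ K : ℝ≥0, ∃ U ∈ 𝓝[E] z₀, ∀ t ∈ Icc 0 T, LipschitzOnWith K (f t) U

/-- Piecewise continuous in `t ≥ 0` for each `z ∈ E`, and (locally) Lipschitz in `z ∈ E`. -/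
def PiecewiseContLipschitz {n : ℕ} {F : Type*} [PseudoEMetricSpace F]
    (E : Set (Vec n)) (f : ℝ → Vec n → F) : Prop :=
  (∀ z ∈ E, PiecewiseContinuous fun t => f t z) ∧ LipschitzInState E f

/-- Locally uniformly in `z ∈ E` and `t ∈ [0, T]`, the nonzero values of `b` stay away from `0`:
`b` does not tend to `0` through nonzero values. -/
def NonzeroValuesAwayFromZero {n : ℕ} (E : Set (Vec n)) (b : ℝ → Vec n → ℝ) : Prop :=
  ∀ T : ℝ, ∀ z₀ ∈ E, ∃ ε > 0, ∃ U ∈ 𝓝[E] z₀, ∀ t ∈ Icc 0 T, ∀ z ∈ U, b t z = 0 ∨ ε ≤ |b t z|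

/-! ### System, observer and closed loop -/

/-- The system `ẋ = f(x) + g(x) u + g_d(x) d(t)`, `y = c(x) + c_d(x) v(t)` on an open state set
`X ⊆ ℝⁿ`. Matrices are written as linear maps between Euclidean spaces. -/
structure ControlSystem (n m ny nd nv : ℕ) where
  X : Set (Vec n)
  isOpen_X : IsOpen X
  f : Vec n → Vec n
  g : Vec n → Vec m →L[ℝ] Vec n
  gd : Vec n → Vec nd →L[ℝ] Vec n
  c : Vec n → Vec ny
  cd : Vec n → Vec nv →L[ℝ] Vec ny
  d : ℝ → Vec nd
  v : ℝ → Vec nv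
  dbar : ℝ
  vbar : ℝ
  f_lip : LocallyLipschitzOn X f
  g_lip : LocallyLipschitzOn X g
  gd_lip : LocallyLipschitzOn X gd
  c_lip : LocallyLipschitzOn X c
  cd_lip : LocallyLipschitzOn X cd
  d_pc : PiecewiseContinuous d
  v_pc : PiecewiseContinuous v
  d_bound : ∀ t : ℝ, 0 ≤ t → ‖d t‖ ≤ dbar
  v_bound : ∀ t : ℝ, 0 ≤ t → ‖v t‖ ≤ vbar

/-- The observer `x̂' = p(x̂, y) + q(x̂, y) u`. -/
structure Observer {n m ny nd nv : ℕ} (sys : ControlSystem n m ny nd nv) where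
  p : Vec n → Vec ny → Vec n
  q : Vec n → Vec ny → Vec m →L[ℝ] Vec n
  p_lip : LocallyLipschitzOn (sys.X ×ˢ univ) fun z : Vec n × Vec ny => p z.1 z.2
  q_lip : LocallyLipschitzOn (sys.X ×ˢ univ) fun z : Vec n × Vec ny => q z.1 z.2

section ClosedLoop

variable {n m ny nd nv : ℕ} (sys : ControlSystem n m ny nd nv)

/-- The measured output at time `t` in state `x`. -/
def ControlSystem.output (t : ℝ) (x : Vec n) : Vec ny :=
  sys.c x + sys.cd x (sys.v t)

/-- The right-hand side of the state equation. -/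
def ControlSystem.stateField (t : ℝ) (x : Vec n) (u : Vec m) : Vec n :=
  sys.f x + sys.g x u + sys.gd x (sys.d t)

variable {sys}

/-- The right-hand side of the observer equation. -/
def Observer.field (obs : Observer sys) (xh : Vec n) (y : Vec ny) (u : Vec m) : Vec n :=
  obs.p xh y + obs.q xh y u

/-- `(x, xh)` solves, on `[0, T)` and with the estimate in `E`, the closed loop formed by the system,
the observer and the estimate-feedback controller `u = π(t, x̂)` (integral form of the ODE). -/
structure IsClosedLoopSolution (obs : Observer sys) (E : Set (Vec n)) (π : ℝ → Vec n → Vec m)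
    (T : ℝ) (x xh : ℝ → Vec n) : Prop where
  state_mem : ∀ t ∈ Ico 0 T, x t ∈ sys.X
  estimate_mem : ∀ t ∈ Ico 0 T, xh t ∈ E
  state_cont : ContinuousOn x (Ico 0 T)
  estimate_cont : ContinuousOn xh (Ico 0 T)
  state_integrable : ∀ t ∈ Ico 0 T,
    IntervalIntegrable (fun s => sys.stateField s (x s) (π s (xh s))) volume 0 t
  state_eq : ∀ t ∈ Ico 0 T,
    x t = x 0 + ∫ s in (0 : ℝ)..t, sys.stateField s (x s) (π s (xh s))
  estimate_integrable : ∀ t ∈ Ico 0 T,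
    IntervalIntegrable (fun s => obs.field (xh s) (sys.output s (x s)) (π s (xh s))) volume 0 t
  estimate_eq : ∀ t ∈ Ico 0 T,
    xh t = xh 0 + ∫ s in (0 : ℝ)..t, obs.field (xh s) (sys.output s (x s)) (π s (xh s))

/-- Bounded-error observer, in the loop with the controller `π`: if `x(0) ∈ D(x̂(0))`, then
`x(t) ∈ P(t, x̂(t))` as long as the solution exists. -/
structure IsBoundedErrorObserver (obs : Observer sys) (E : Set (Vec n)) (π : ℝ → Vec n → Vec m)
    (D : Vec n → Set (Vec n)) (P : ℝ → Vec n → Set (Vec n)) : Prop where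
  D_sub : ∀ z ∈ E, D z ⊆ sys.X
  D_bdd : ∀ z ∈ E, Bornology.IsBounded (D z)
  P_sub : ∀ t : ℝ, 0 ≤ t → ∀ z ∈ E, P t z ⊆ sys.X
  P_bdd : ∀ t : ℝ, 0 ≤ t → ∀ z ∈ E, Bornology.IsBounded (P t z)
  error_bound : ∀ (T : ℝ) (x xh : ℝ → Vec n), IsClosedLoopSolution obs E π T x xh →
    x 0 ∈ D (xh 0) → ∀ t ∈ Ico 0 T, x t ∈ P t (xh t)

/-- Every closed-loop solution with `x̂(0) ∈ Xh0` and `x(0) ∈ X0 (x̂(0))` stays in `S`. -/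
def RendersSafe (obs : Observer sys) (E : Set (Vec n)) (π : ℝ → Vec n → Vec m)
    (S : Set (Vec n)) (X0 : Vec n → Set (Vec n)) (Xh0 : Set (Vec n)) : Prop :=
  ∀ (T : ℝ) (x xh : ℝ → Vec n), IsClosedLoopSolution obs E π T x xh →
    xh 0 ∈ Xh0 → x 0 ∈ X0 (xh 0) → ∀ t ∈ Ico 0 T, x t ∈ S

end ClosedLoop

/-! ### Barrier functions -/

section Barrier

variable {n m ny nd nv : ℕ} (sys : ControlSystem n m ny nd nv)

/-- The safe set `{x ∈ X : h(x) ≥ 0}`. -/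
def safeSet (h : Vec n → ℝ) : Set (Vec n) := {x | x ∈ sys.X ∧ 0 ≤ h x}

/-- `L_f h(x)`. -/
def lieF (h : Vec n → ℝ) (x : Vec n) : ℝ := fderiv ℝ h x (sys.f x)

/-- The row vector `L_g h(x)`, as a linear functional of the input. -/
def lieG (h : Vec n → ℝ) (x : Vec n) : Vec m →L[ℝ] ℝ := (fderiv ℝ h x).comp (sys.g x)

/-- The component `[L_g h(x)]_i`. -/
def lieGComp (h : Vec n → ℝ) (x : Vec n) (i : Fin m) : ℝ :=
  lieG sys h x (EuclideanSpace.single i 1)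

/-- The row vector `L_{g_d} h(x)`; its operator norm is its Euclidean norm. -/
def lieGd (h : Vec n → ℝ) (x : Vec n) : Vec nd →L[ℝ] ℝ := (fderiv ℝ h x).comp (sys.gd x)

/-- A class-`K` function on `[0, ∞)`, extended to negative arguments in some nondecreasing way
(so that `α (h x)` makes sense when `h x < 0`). -/
structure IsClassK (α : ℝ → ℝ) : Prop where
  cont : ContinuousOn α (Ici 0)
  strictMono : StrictMonoOn α (Ici 0)
  zero : α 0 = 0
  mono : Monotone α

/-- A continuous nonincreasing `κ : [0, ∞) → ℝ` with `κ(0) = 1`, extended to negative arguments in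
some nonincreasing way. -/
structure IsTuning (κ : ℝ → ℝ) : Prop where
  cont : ContinuousOn κ (Ici 0)
  zero : κ 0 = 1
  anti : Antitone κ

/-- `h` is a tunable robust control barrier function for input set `Uset`, with witnesses `α`, `κ`.
The supremum is taken in the extended reals. -/
structure IsTRCBF (Uset : Set (Vec m)) (h : Vec n → ℝ) (α κ : ℝ → ℝ) : Prop where
  contDiff : ContDiffOn ℝ 1 h sys.X
  classK : IsClassK α
  tuning : IsTuning κ
  barrier : ∀ x ∈ safeSet sys h,
    ((κ (h x) * ‖lieGd sys h x‖ * sys.dbar : ℝ) : EReal) ≤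
      ⨆ u ∈ Uset, ((lieF sys h x + lieG sys h x u + α (h x) : ℝ) : EReal)

/-- `a` bounds from below the terms of `ḣ` that do not involve the input,
over all states in `P(t, x̂)`. -/
structure IsDriftBound (E : Set (Vec n)) (P : ℝ → Vec n → Set (Vec n)) (h : Vec n → ℝ)
    (α κ : ℝ → ℝ) (wbar : ℝ) (a : ℝ → Vec n → ℝ) : Prop where
  regular : PiecewiseContLipschitz E a
  lower : ∀ t : ℝ, 0 ≤ t → ∀ z ∈ E, ∀ x ∈ P t z,
    a t z ≤ lieF sys h x - κ (h x) * ‖lieGd sys h x‖ * wbar + α (h x)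

/-- `bm i ≤ [L_g h]_i ≤ bp i` over all states in `P(t, x̂)`, with bounds of equal sign. -/
structure IsGainBound (E : Set (Vec n)) (P : ℝ → Vec n → Set (Vec n)) (h : Vec n → ℝ)
    (bm bp : Fin m → ℝ → Vec n → ℝ) : Prop where
  regular_m : ∀ i, PiecewiseContLipschitz E (bm i)
  regular_p : ∀ i, PiecewiseContLipschitz E (bp i)
  bounds : ∀ i, ∀ t : ℝ, 0 ≤ t → ∀ z ∈ E, ∀ x ∈ P t z,
    bm i t z ≤ lieGComp sys h x i ∧ lieGComp sys h x i ≤ bp i t z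
  sign_eq : ∀ i, ∀ t : ℝ, 0 ≤ t → ∀ z ∈ E,
    SignType.sign (bm i t z) = SignType.sign (bp i t z)
  away_m : ∀ i, NonzeroValuesAwayFromZero E (bm i)
  away_p : ∀ i, NonzeroValuesAwayFromZero E (bp i)
  relDegOne : ∀ t : ℝ, 0 ≤ t → ∀ z ∈ E, ∃ x ∈ P t z, lieG sys h x ≠ 0

end Barrier

/-! ### The quadratic program -/

/-- The feasible set `{u : a + ∑ min{b_i⁻ u_i, b_i⁺ u_i} ≥ 0}` at a given `(t, x̂)`. -/
def qpFeasible {m : ℕ} (a : ℝ) (bm bp : Fin m → ℝ) : Set (Vec m) :=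
  {u | 0 ≤ a + ∑ i, min (bm i * u i) (bp i * u i)}

/-- `u` minimizes `‖u - udes‖²` over the feasible set. -/
def IsQPSolution {m : ℕ} (a : ℝ) (bm bp : Fin m → ℝ) (udes u : Vec m) : Prop :=
  u ∈ qpFeasible a bm bp ∧ IsMinOn (fun w : Vec m => ‖w - udes‖ ^ 2) (qpFeasible a bm bp) u

/-- `π(t, x̂)` solves the quadratic program for all `t ≥ 0` and `x̂ ∈ E`. -/
def IsQPController {n m : ℕ} (E : Set (Vec n)) (a : ℝ → Vec n → ℝ)
    (bm bp : Fin m → ℝ → Vec n → ℝ) (πdes π : ℝ → Vec n → Vec m) : Prop :=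
  ∀ t : ℝ, 0 ≤ t → ∀ z ∈ E,
    IsQPSolution (a t z) (fun i => bm i t z) (fun i => bp i t z) (πdes t z) (π t z)

end

/-! The program minimizes a strongly convex function under one concave separable constraint, so it
is governed by a single multiplier `l ≥ 0`. For fixed `l` the Lagrangian splits into scalar
problems, solved explicitly by `qpCoord`. Because the bounds of each gain share a sign and stay away
from zero when nonzero, raising `l` raises the constraint by at least `ε` times the displacement of
each coordinate (`qpCoord_gain_mono`). Some gain is nonzero, so the constraint is met at an explicit
`l`, and the intermediate value theorem gives a bounded multiplier (`QPBounds.exists_multiplier`). A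
Pythagorean inequality turns multipliers into unique minimizers.

For two sets of data, the points at a common multiplier are close. The remaining displacement, due
to the change of multiplier, is paid for by a constraint gap that is small because the program with
the larger multiplier has an active constraint. Hence the solution is Lipschitz in the data on
bounded sets (`QPBounds.norm_solution_sub_le`), and `π` inherits the regularity of the data.

For safety, if `h` becomes negative along a solution, look at the time since it was last
nonnegative. There `α(h) ≤ 0` and `κ(h) ≥ 1`, so feasibility of `u` forces `h` not to decrease
(`fderiv_stateField_nonneg`). Right derivatives suffice, since the velocity has right limits
everywhere. -/

/-! ### The scalar Lagrangian problem in one coordinate -/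

/-- Coordinate of the minimizer of the Lagrangian of the quadratic program. -/
noncomputable def qpCoord (p q k l : ℝ) : ℝ := max (k + l * p) 0 + min (k + l * q) 0

/-- An ordered pair of bounds of equal sign, which is either zero or at distance `ε` from zero. -/
def GainPair (ε p q : ℝ) : Prop :=
  (p = 0 ∧ q = 0) ∨ (ε ≤ p ∧ p ≤ q) ∨ (p ≤ q ∧ q ≤ -ε)

theorem GainPair.le {ε p q : ℝ} (h : GainPair ε p q) : p ≤ q := by
  rcases h with ⟨rfl, rfl⟩ | h | h
  · exact le_rfl
  · exact h.2
  · exact h.1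

theorem GainPair.of_sign_eq {ε p q : ℝ} (hpq : p ≤ q)
    (hs : SignType.sign p = SignType.sign q) (hp : p = 0 ∨ ε ≤ |p|) (hq : q = 0 ∨ ε ≤ |q|) :
    GainPair ε p q := by
  rcases lt_trichotomy p 0 with h | h | h
  · rw [sign_neg h, eq_comm, sign_eq_neg_one_iff] at hs
    rw [abs_of_neg hs] at hq
    right; right
    refine ⟨hpq, ?_⟩
    rcases hq with hq | hq <;> linarith
  · rw [h, sign_zero, eq_comm, sign_eq_zero_iff] at hs
    exact Or.inl ⟨h, hs⟩
  · rw [abs_of_pos h] at hp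
    right; left
    refine ⟨?_, hpq⟩
    rcases hp with hp | hp <;> linarith

theorem min_mul_of_nonneg_arg {p q u : ℝ} (h : p ≤ q) (hu : 0 ≤ u) :
    min (p * u) (q * u) = p * u :=
  min_eq_left (mul_le_mul_of_nonneg_right h hu)

theorem min_mul_of_nonpos_arg {p q u : ℝ} (h : p ≤ q) (hu : u ≤ 0) :
    min (p * u) (q * u) = q * u :=
  min_eq_right (mul_le_mul_of_nonpos_right h hu)

/-- This is the first-order condition: the displacement from `k` is `l` times a supergradient of the
concave function `min (p * ·) (q * ·)`, whose slope is `p` on the right of `0`, `q` on the left, and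
anything in `[p, q]` at `0`. -/
theorem qpCoord_stationary {p q k l : ℝ} (hpq : p ≤ q) (hl : 0 ≤ l) (w : ℝ) :
    l * (min (p * w) (q * w) - min (p * qpCoord p q k l) (q * qpCoord p q k l)) ≤
      (qpCoord p q k l - k) * (w - qpCoord p q k l) := by
  have hlpq := mul_le_mul_of_nonneg_left hpq hl
  rcases le_total 0 (k + l * p) with h1 | h1
  · have hu : qpCoord p q k l = k + l * p := by
      rw [qpCoord, max_eq_left h1, min_eq_right (by linarith), add_zero]
    rw [hu, min_mul_of_nonneg_arg hpq h1]
    have := mul_le_mul_of_nonneg_left (min_le_left (p * w) (q * w)) hl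
    linarith
  rcases le_total (k + l * q) 0 with h2 | h2
  · have hu : qpCoord p q k l = k + l * q := by
      rw [qpCoord, max_eq_right h1, min_eq_left h2, zero_add]
    rw [hu, min_mul_of_nonpos_arg hpq h2]
    have := mul_le_mul_of_nonneg_left (min_le_right (p * w) (q * w)) hl
    linarith
  · have hu : qpCoord p q k l = 0 := by
      rw [qpCoord, max_eq_right h1, min_eq_right h2, zero_add]
    rw [hu]
    rcases le_total 0 w with hw | hw
    · rw [min_mul_of_nonneg_arg hpq hw]
      simp only [mul_zero, min_self]
      nlinarith
    · rw [min_mul_of_nonpos_arg hpq hw]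
      simp only [mul_zero, min_self]
      nlinarith

theorem mul_sub_le_min_mul_sub {ε p q u v : ℝ} (hε : ε ≤ p) (hpq : p ≤ q) (huv : u ≤ v) :
    ε * (v - u) ≤ min (p * v) (q * v) - min (p * u) (q * u) := by
  have h1 : ε * (v - u) ≤ p * (v - u) := mul_le_mul_of_nonneg_right hε (by linarith)
  have h2 : ε * (v - u) ≤ q * (v - u) := mul_le_mul_of_nonneg_right (hε.trans hpq) (by linarith)
  rw [le_sub_iff_add_le, le_min_iff]
  constructor
  · linarith [min_le_left (p * u) (q * u)]
  · linarith [min_le_right (p * u) (q * u)]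

theorem min_mul_neg (p q u : ℝ) : min (p * u) (q * u) = min (-q * -u) (-p * -u) := by
  rw [neg_mul_neg, neg_mul_neg, min_comm]

/-- When both slopes are at least `ε`, the coordinate increases with `l` and the concave gain
increases with the coordinate at rate at least `ε`. Negative slopes reduce to this by reflection,
and zero slopes freeze the coordinate. -/
theorem qpCoord_gain_mono {ε p q k l l' : ℝ} (hε : 0 < ε) (hpq : GainPair ε p q)
    (hll : l ≤ l') :
    ε * |qpCoord p q k l' - qpCoord p q k l| ≤
      min (p * qpCoord p q k l') (q * qpCoord p q k l') -
        min (p * qpCoord p q k l) (q * qpCoord p q k l) := by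
  rcases hpq with ⟨rfl, rfl⟩ | ⟨h1, h2⟩ | ⟨h1, h2⟩
  · simp [qpCoord]
  · have hu : qpCoord p q k l ≤ qpCoord p q k l' := by
      unfold qpCoord
      have hp : 0 ≤ p := by linarith
      have hq : 0 ≤ q := by linarith
      gcongr
    rw [abs_of_nonneg (by linarith)]
    exact mul_sub_le_min_mul_sub h1 h2 hu
  · have hu : qpCoord p q k l' ≤ qpCoord p q k l := by
      unfold qpCoord
      have hp : l' * p ≤ l * p := mul_le_mul_of_nonpos_right hll (by linarith)
      have hq : l' * q ≤ l * q := mul_le_mul_of_nonpos_right hll (by linarith)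
      gcongr
    rw [abs_of_nonpos (by linarith), min_mul_neg p q (qpCoord p q k l'),
      min_mul_neg p q (qpCoord p q k l)]
    have := mul_sub_le_min_mul_sub (le_neg_of_le_neg h2) (neg_le_neg h1) (neg_le_neg hu)
    linarith

/-- A large multiplier overrides `k`: once `l * ε` exceeds `B + R`, the coordinate has the
favourable sign and size at least `R`. -/
theorem qpCoord_gain_ge {ε p q k l B R : ℝ} (hε : 0 < ε) (hpq : GainPair ε p q) (hp0 : p ≠ 0)
    (hk : |k| ≤ B) (hR : 0 ≤ R) (hl : B + R ≤ l * ε) (hl0 : 0 ≤ l) :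
    ε * R ≤ min (p * qpCoord p q k l) (q * qpCoord p q k l) := by
  obtain ⟨hk1, hk2⟩ := abs_le.1 hk
  rcases hpq with ⟨rfl, rfl⟩ | ⟨h1, h2⟩ | ⟨h1, h2⟩
  · exact absurd rfl hp0
  · have e1 := mul_le_mul_of_nonneg_left h1 hl0
    have e2 := mul_le_mul_of_nonneg_left h2 hl0
    have hu : qpCoord p q k l = k + l * p := by
      rw [qpCoord, max_eq_left (by linarith), min_eq_right (by linarith), add_zero]
    have hRu : R ≤ k + l * p := by linarith
    rw [hu, min_mul_of_nonneg_arg h2 (hR.trans hRu)]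
    exact mul_le_mul h1 hRu hR (by linarith)
  · have e1 := mul_le_mul_of_nonneg_left h1 hl0
    have e2 := mul_le_mul_of_nonneg_left h2 hl0
    have hu : qpCoord p q k l = k + l * q := by
      rw [qpCoord, max_eq_right (by linarith), min_eq_left (by linarith), zero_add]
    have hRu : R ≤ -(k + l * q) := by linarith
    rw [hu, min_mul_of_nonpos_arg h1 (by linarith)]
    have := mul_le_mul (le_neg_of_le_neg h2) hRu hR (by linarith)
    linarith

theorem qpCoord_zero (p q k : ℝ) : qpCoord p q k 0 = k := by
  simp [qpCoord, max_add_min]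

theorem abs_min_mul_le {p q u B C : ℝ} (hp : |p| ≤ B) (hq : |q| ≤ B) (hu : |u| ≤ C) :
    |min (p * u) (q * u)| ≤ B * C := by
  refine (abs_min_le_max_abs_abs).trans (max_le ?_ ?_) <;> rw [abs_mul] <;>
    exact mul_le_mul (by assumption) hu (abs_nonneg _) ((abs_nonneg _).trans hp)

theorem abs_qpCoord_le {p q k l B L : ℝ} (hp : |p| ≤ B) (hq : |q| ≤ B) (hk : |k| ≤ B)
    (hl : l ∈ Icc 0 L) : |qpCoord p q k l| ≤ 2 * (B + L * B) := by
  have hB : 0 ≤ B := (abs_nonneg _).trans hp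
  have key : ∀ r : ℝ, |r| ≤ B → |k + l * r| ≤ B + L * B := fun r hr => by
    refine (abs_add_le _ _).trans (add_le_add hk ?_)
    rw [abs_mul, abs_of_nonneg hl.1]
    exact mul_le_mul hl.2 hr (abs_nonneg _) (hl.1.trans hl.2)
  have h0 : |(0 : ℝ)| ≤ B + L * B := by
    rw [abs_zero]; exact (abs_nonneg _).trans (key p hp)
  refine (abs_add_le _ _).trans ?_
  have e1 := (abs_max_le_max_abs_abs (a := k + l * p) (b := 0)).trans (max_le (key p hp) h0)
  have e2 := (abs_min_le_max_abs_abs (a := k + l * q) (b := 0)).trans (max_le (key q hq) h0)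
  linarith

theorem abs_qpCoord_sub_le {p q k p' q' k' l L δ : ℝ} (hp : |p - p'| ≤ δ) (hq : |q - q'| ≤ δ)
    (hk : |k - k'| ≤ δ) (hl : l ∈ Icc 0 L) :
    |qpCoord p q k l - qpCoord p' q' k' l| ≤ 2 * (1 + L) * δ := by
  have key : ∀ r r' : ℝ, |r - r'| ≤ δ → |(k + l * r) - (k' + l * r')| ≤ (1 + L) * δ :=
    fun r r' hr => by
    have : (k + l * r) - (k' + l * r') = (k - k') + l * (r - r') := by ring
    rw [this, add_mul, one_mul]
    refine (abs_add_le _ _).trans (add_le_add hk ?_)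
    rw [abs_mul, abs_of_nonneg hl.1]
    exact mul_le_mul hl.2 hr (abs_nonneg _) (hl.1.trans hl.2)
  have e1 := (abs_max_sub_max_le_abs (k + l * p) (k' + l * p') 0).trans (key p p' hp)
  have e2 := (abs_min_sub_min_le_max (k + l * q) 0 (k' + l * q') 0).trans
    (max_le (key q q' hq) (by rw [sub_self, abs_zero]; exact (abs_nonneg _).trans (key p p' hp)))
  have : qpCoord p q k l - qpCoord p' q' k' l =
      (max (k + l * p) 0 - max (k' + l * p') 0) + (min (k + l * q) 0 - min (k' + l * q') 0) := by
    unfold qpCoord; ring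
  rw [this]
  exact (abs_add_le _ _).trans (by linarith)

theorem abs_min_mul_sub_le {p q u p' q' u' B M δ η : ℝ} (hp : |p - p'| ≤ δ) (hq : |q - q'| ≤ δ)
    (hu : |u - u'| ≤ η) (hpB : |p| ≤ B) (hqB : |q| ≤ B) (hM : |u'| ≤ M) :
    |min (p * u) (q * u) - min (p' * u') (q' * u')| ≤ B * η + δ * M := by
  have key : ∀ r r' : ℝ, |r - r'| ≤ δ → |r| ≤ B → |r * u - r' * u'| ≤ B * η + δ * M :=
    fun r r' hr hrB => by
    have : r * u - r' * u' = r * (u - u') + (r - r') * u' := by ring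
    rw [this]
    refine (abs_add_le _ _).trans ?_
    rw [abs_mul, abs_mul]
    exact add_le_add (mul_le_mul hrB hu (abs_nonneg _) ((abs_nonneg _).trans hrB))
      (mul_le_mul hr hM (abs_nonneg _) ((abs_nonneg _).trans hr))
  exact (abs_min_sub_min_le_max _ _ _ _).trans (max_le (key p p' hp hpB) (key q q' hq hqB))

/-! ### Multipliers, uniqueness and Lipschitz dependence for the quadratic program -/

section QP

variable {m : ℕ}

/-- The minimizer of the Lagrangian of the quadratic program with multiplier `l`. -/
noncomputable def qpPoint (bm bp : Fin m → ℝ) (k : Vec m) (l : ℝ) : Vec m :=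
  WithLp.toLp 2 fun i => qpCoord (bm i) (bp i) (k i) l

/-- The constraint function of the quadratic program. -/
noncomputable def qpConstraint (a : ℝ) (bm bp : Fin m → ℝ) (u : Vec m) : ℝ :=
  a + ∑ i, min (bm i * u i) (bp i * u i)

/-- Quantitative bounds on the data of the quadratic program. -/
structure QPBounds (B ε : ℝ) (a : ℝ) (bm bp : Fin m → ℝ) (k : Vec m) : Prop where
  eps_pos : 0 < ε
  abs_a : |a| ≤ B
  abs_bm : ∀ i, |bm i| ≤ B
  abs_bp : ∀ i, |bp i| ≤ B
  abs_k : ∀ i, |k i| ≤ B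
  pair : ∀ i, GainPair ε (bm i) (bp i)
  active : ∃ i, bm i ≠ 0

/-- A Karush-Kuhn-Tucker multiplier of the quadratic program. -/
structure IsMultiplier (a : ℝ) (bm bp : Fin m → ℝ) (k : Vec m) (l : ℝ) : Prop where
  nonneg : 0 ≤ l
  feasible : 0 ≤ qpConstraint a bm bp (qpPoint bm bp k l)
  slack : l * qpConstraint a bm bp (qpPoint bm bp k l) = 0

/-- Complementary slackness and the coordinatewise stationarity make the angle at the candidate
point obtuse. The extra square on the left yields uniqueness as well as optimality. -/
theorem IsMultiplier.norm_sq_add_le {a : ℝ} {bm bp : Fin m → ℝ} {k : Vec m} {l : ℝ}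
    (hl : IsMultiplier a bm bp k l) (hb : ∀ i, bm i ≤ bp i) {w : Vec m}
    (hw : w ∈ qpFeasible a bm bp) :
    ‖qpPoint bm bp k l - k‖ ^ 2 + ‖w - qpPoint bm bp k l‖ ^ 2 ≤ ‖w - k‖ ^ 2 := by
  have hw' : 0 ≤ qpConstraint a bm bp w := hw
  have h1 : 0 ≤ ∑ i, (qpPoint bm bp k l i - k i) * (w i - qpPoint bm bp k l i) := by
    calc 0 ≤ l * (qpConstraint a bm bp w - qpConstraint a bm bp (qpPoint bm bp k l)) := by
            rw [mul_sub, hl.slack, sub_zero]; exact mul_nonneg hl.nonneg hw'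
      _ = ∑ i, l * (min (bm i * w i) (bp i * w i) -
            min (bm i * qpPoint bm bp k l i) (bp i * qpPoint bm bp k l i)) := by
            rw [← Finset.mul_sum, Finset.sum_sub_distrib]; unfold qpConstraint; ring
      _ ≤ _ := Finset.sum_le_sum fun i _ => qpCoord_stationary (hb i) hl.nonneg (w i)
  simp only [EuclideanSpace.norm_sq_eq, Real.norm_eq_abs, sq_abs, PiLp.sub_apply]
  rw [← Finset.sum_add_distrib, ← sub_nonneg, ← Finset.sum_sub_distrib]
  calc (0 : ℝ) ≤ 2 * ∑ i, (qpPoint bm bp k l i - k i) * (w i - qpPoint bm bp k l i) := by linarith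
    _ = _ := by rw [Finset.mul_sum]; exact Finset.sum_congr rfl fun i _ => by ring

theorem IsMultiplier.isQPSolution {a : ℝ} {bm bp : Fin m → ℝ} {k : Vec m} {l : ℝ}
    (hl : IsMultiplier a bm bp k l) (hb : ∀ i, bm i ≤ bp i) :
    IsQPSolution a bm bp k (qpPoint bm bp k l) :=
  ⟨hl.feasible, fun w hw => by
    have := hl.norm_sq_add_le hb hw
    have := sq_nonneg ‖w - qpPoint bm bp k l‖
    show ‖qpPoint bm bp k l - k‖ ^ 2 ≤ ‖w - k‖ ^ 2
    linarith⟩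

theorem IsMultiplier.eq_qpPoint {a : ℝ} {bm bp : Fin m → ℝ} {k : Vec m} {l : ℝ}
    (hl : IsMultiplier a bm bp k l) (hb : ∀ i, bm i ≤ bp i) {u : Vec m}
    (hu : IsQPSolution a bm bp k u) : u = qpPoint bm bp k l := by
  have h1 := hl.norm_sq_add_le hb hu.1
  have h2 : ‖u - k‖ ^ 2 ≤ ‖qpPoint bm bp k l - k‖ ^ 2 := hu.2 hl.feasible
  have h3 : ‖u - qpPoint bm bp k l‖ ^ 2 = 0 := le_antisymm (by linarith) (sq_nonneg _)
  exact sub_eq_zero.1 (norm_eq_zero.1 (pow_eq_zero_iff two_ne_zero |>.1 h3))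

theorem continuous_qpConstraint_qpPoint (a : ℝ) (bm bp : Fin m → ℝ) (k : Vec m) :
    Continuous fun l => qpConstraint a bm bp (qpPoint bm bp k l) := by
  unfold qpConstraint qpPoint qpCoord
  fun_prop

/-- An a priori bound for the multiplier. -/
noncomputable def multiplierBound (m : ℕ) (B ε : ℝ) : ℝ := (B + (B + m * (B * B)) / ε) / ε

theorem QPBounds.exists_multiplier {B ε a : ℝ} {bm bp : Fin m → ℝ} {k : Vec m}
    (h : QPBounds B ε a bm bp k) :
    ∃ l ≤ multiplierBound m B ε, IsMultiplier a bm bp k l := by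
  have hε := h.eps_pos
  have hB : 0 ≤ B := (abs_nonneg _).trans h.abs_a
  -- `R` is chosen so that one active coordinate contributes `ε * R = B + m * B²`, enough to offset
  -- `a ≥ -B` and a loss of at most `B²` per coordinate.
  set R := (B + m * (B * B)) / ε with hR
  have hR0 : 0 ≤ R := by positivity
  have hL0 : 0 ≤ multiplierBound m B ε := by unfold multiplierBound; positivity
  have hLε : multiplierBound m B ε * ε = B + R := by
    exact div_mul_cancel₀ _ hε.ne'
  by_cases h0 : 0 ≤ qpConstraint a bm bp (qpPoint bm bp k 0)
  · exact ⟨0, hL0, le_rfl, h0, zero_mul _⟩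
  have hL : 0 ≤ qpConstraint a bm bp (qpPoint bm bp k (multiplierBound m B ε)) := by
    obtain ⟨i, hi⟩ := h.active
    set L := multiplierBound m B ε
    -- No coordinate falls below its value at `l = 0`, where the coordinate is `k j`.
    have hge : ∀ j, -(B * B) ≤ min (bm j * qpCoord (bm j) (bp j) (k j) L)
        (bp j * qpCoord (bm j) (bp j) (k j) L) := fun j => by
      have h1 := qpCoord_gain_mono (k := k j) hε (h.pair j) hL0
      have h2 : 0 ≤ ε * |qpCoord (bm j) (bp j) (k j) L - qpCoord (bm j) (bp j) (k j) 0| := by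
        positivity
      rw [qpCoord_zero] at h1 h2
      have h3 := (abs_le.1 (abs_min_mul_le (h.abs_bm j) (h.abs_bp j) (h.abs_k j))).1
      linarith
    have h1 := Finset.single_le_sum (s := Finset.univ)
      (f := fun j => min (bm j * qpCoord (bm j) (bp j) (k j) L)
        (bp j * qpCoord (bm j) (bp j) (k j) L) + B * B)
      (fun j _ => by linarith [hge j]) (Finset.mem_univ i)
    have h2 := qpCoord_gain_ge hε (h.pair i) hi (h.abs_k i) hR0 hLε.ge hL0
    have h3 : ε * R = B + m * (B * B) := by rw [hR]; field_simp
    have h4 := (abs_le.1 h.abs_a).1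
    have h5 : 0 ≤ B * B := mul_nonneg hB hB
    rw [Finset.sum_add_distrib, Finset.sum_const, Finset.card_univ, Fintype.card_fin,
      nsmul_eq_mul] at h1
    unfold qpConstraint qpPoint
    dsimp only at h1 ⊢
    linarith
  obtain ⟨l, hl, hl'⟩ := intermediate_value_Icc hL0
    (continuous_qpConstraint_qpPoint a bm bp k).continuousOn
    (show (0 : ℝ) ∈ Icc _ _ from ⟨(not_le.1 h0).le, hL⟩)
  exact ⟨l, hl.2, hl.1, hl'.ge, by dsimp only at hl'; rw [hl', mul_zero]⟩

theorem QPBounds.existsUnique {B ε a : ℝ} {bm bp : Fin m → ℝ} {k : Vec m}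
    (h : QPBounds B ε a bm bp k) : ∃! u, IsQPSolution a bm bp k u := by
  obtain ⟨l, -, hl⟩ := h.exists_multiplier
  exact ⟨_, hl.isQPSolution fun i => (h.pair i).le,
    fun u hu => hl.eq_qpPoint (fun i => (h.pair i).le) hu⟩

/-- A Lipschitz constant for the constraint along the Lagrangian minimizers. -/
noncomputable def constraintLip (m : ℕ) (B ε : ℝ) : ℝ :=
  1 + m * (4 * B * (1 + multiplierBound m B ε))

/-- A Lipschitz constant for the solution of the quadratic program as a function of the data. -/
noncomputable def qpLip (m : ℕ) (B ε : ℝ) : ℝ :=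
  m * (2 * (1 + multiplierBound m B ε) + constraintLip m B ε / ε)

theorem norm_le_of_abs_coord_le {u : Vec m} {C : ℝ} (h : ∀ i, |u i| ≤ C) : ‖u‖ ≤ m * C := by
  calc ‖u‖ = ‖∑ i, EuclideanSpace.single i (u i)‖ := by
        congr 1; ext j; simp [Pi.single_apply]
    _ ≤ ∑ i, ‖EuclideanSpace.single i (u i)‖ := norm_sum_le _ _
    _ ≤ ∑ _i : Fin m, C := Finset.sum_le_sum fun i _ => by simpa using h i
    _ = m * C := by simp

/-- The two points are compared through the second program's point at the larger multiplier `l`.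
Multipliers themselves need not be close, or even unique. -/
theorem norm_qpPoint_sub_le_of_le {B ε a a' δ l l' : ℝ} {bm bp bm' bp' : Fin m → ℝ} {k k' : Vec m}
    (h : QPBounds B ε a bm bp k) (h' : QPBounds B ε a' bm' bp' k')
    (hl : IsMultiplier a bm bp k l) (hl' : IsMultiplier a' bm' bp' k' l') (hle : l' ≤ l)
    (hL : l ≤ multiplierBound m B ε)
    (ha : |a - a'| ≤ δ) (hm : ∀ i, |bm i - bm' i| ≤ δ) (hp : ∀ i, |bp i - bp' i| ≤ δ)
    (hk : ∀ i, |k i - k' i| ≤ δ) :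
    ‖qpPoint bm bp k l - qpPoint bm' bp' k' l'‖ ≤ qpLip m B ε * δ := by
  have hε := h.eps_pos
  have hδ : 0 ≤ δ := (abs_nonneg _).trans ha
  have hB : 0 ≤ B := (abs_nonneg _).trans h.abs_a
  set L := multiplierBound m B ε
  have hL0 : 0 ≤ L := hl.nonneg.trans hL
  have hlI : l ∈ Icc 0 L := ⟨hl.nonneg, hL⟩
  have hpt : ∀ i, |qpCoord (bm i) (bp i) (k i) l - qpCoord (bm' i) (bp' i) (k' i) l| ≤
      2 * (1 + L) * δ := fun i => abs_qpCoord_sub_le (hm i) (hp i) (hk i) hlI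
  have hcon : |qpConstraint a bm bp (qpPoint bm bp k l) -
      qpConstraint a' bm' bp' (qpPoint bm' bp' k' l)| ≤ constraintLip m B ε * δ := by
    have : qpConstraint a bm bp (qpPoint bm bp k l) -
        qpConstraint a' bm' bp' (qpPoint bm' bp' k' l) = (a - a') +
        ∑ i, (min (bm i * qpCoord (bm i) (bp i) (k i) l) (bp i * qpCoord (bm i) (bp i) (k i) l) -
          min (bm' i * qpCoord (bm' i) (bp' i) (k' i) l)
            (bp' i * qpCoord (bm' i) (bp' i) (k' i) l)) := by
      rw [Finset.sum_sub_distrib]; unfold qpConstraint qpPoint; ring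
    rw [this]
    refine (abs_add_le _ _).trans ?_
    rw [constraintLip, add_mul, one_mul]
    refine add_le_add ha ((Finset.abs_sum_le_sum_abs _ _).trans ?_)
    -- Each summand changes by at most `B * (2(1 + L)δ)` from the point and `δ * 2(B + LB)` from the
    -- slopes.
    calc _ ≤ ∑ _i : Fin m, 4 * B * (1 + L) * δ := Finset.sum_le_sum fun i _ => by
            refine (abs_min_mul_sub_le (hm i) (hp i) (hpt i) (h.abs_bm i) (h.abs_bp i)
              (abs_qpCoord_le (h'.abs_bm i) (h'.abs_bp i) (h'.abs_k i) hlI)).trans (le_of_eq ?_)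
            ring
      _ = _ := by
            rw [Finset.sum_const, Finset.card_univ, Fintype.card_fin, nsmul_eq_mul]; ring
  have hc0 : 0 ≤ constraintLip m B ε * δ := (abs_nonneg _).trans hcon
  -- If `l' < l` then `l > 0`, so the first constraint vanishes at `l` and the second is small
  -- there, while at `l'` it is nonnegative.
  have hgap : qpConstraint a' bm' bp' (qpPoint bm' bp' k' l) -
      qpConstraint a' bm' bp' (qpPoint bm' bp' k' l') ≤ constraintLip m B ε * δ := by
    rcases hle.eq_or_lt with rfl | hlt
    · rwa [sub_self]
    · have h0 : qpConstraint a bm bp (qpPoint bm bp k l) = 0 :=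
        (mul_eq_zero.1 hl.slack).resolve_left (hl'.nonneg.trans_lt hlt).ne'
      have := (abs_le.1 hcon).1
      have := hl'.feasible
      linarith
  have hmono : ∀ i, ε * |qpCoord (bm' i) (bp' i) (k' i) l - qpCoord (bm' i) (bp' i) (k' i) l'| ≤
      constraintLip m B ε * δ := fun i => by
    refine le_trans ?_ hgap
    have h1 := Finset.single_le_sum (s := Finset.univ)
      (f := fun j => ε * |qpCoord (bm' j) (bp' j) (k' j) l - qpCoord (bm' j) (bp' j) (k' j) l'|)
      (fun j _ => by positivity) (Finset.mem_univ i)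
    refine h1.trans ((Finset.sum_le_sum fun j _ =>
      qpCoord_gain_mono (k := k' j) hε (h'.pair j) hle).trans (le_of_eq ?_))
    rw [Finset.sum_sub_distrib]; unfold qpConstraint qpPoint; ring
  rw [qpLip, mul_assoc]
  refine norm_le_of_abs_coord_le fun i => ?_
  have e1 : |qpCoord (bm' i) (bp' i) (k' i) l - qpCoord (bm' i) (bp' i) (k' i) l'| ≤
      constraintLip m B ε * δ / ε := by
    rw [le_div_iff₀ hε, mul_comm]; exact hmono i
  have e2 : (2 * (1 + multiplierBound m B ε) + constraintLip m B ε / ε) * δ =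
      2 * (1 + L) * δ + constraintLip m B ε * δ / ε := by ring
  rw [e2]
  exact (abs_sub_le _ _ _).trans (add_le_add (hpt i) e1)

theorem QPBounds.norm_solution_sub_le {B ε a a' δ : ℝ} {bm bp bm' bp' : Fin m → ℝ}
    {k k' u u' : Vec m}
    (h : QPBounds B ε a bm bp k) (h' : QPBounds B ε a' bm' bp' k')
    (hu : IsQPSolution a bm bp k u) (hu' : IsQPSolution a' bm' bp' k' u')
    (ha : |a - a'| ≤ δ) (hm : ∀ i, |bm i - bm' i| ≤ δ) (hp : ∀ i, |bp i - bp' i| ≤ δ)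
    (hk : ∀ i, |k i - k' i| ≤ δ) : ‖u - u'‖ ≤ qpLip m B ε * δ := by
  obtain ⟨l, hL, hl⟩ := h.exists_multiplier
  obtain ⟨l', hL', hl'⟩ := h'.exists_multiplier
  rw [hl.eq_qpPoint (fun i => (h.pair i).le) hu, hl'.eq_qpPoint (fun i => (h'.pair i).le) hu']
  rcases le_total l' l with hll | hll
  · exact norm_qpPoint_sub_le_of_le h h' hl hl' hll hL ha hm hp hk
  · rw [norm_sub_rev]
    refine norm_qpPoint_sub_le_of_le h' h hl' hl hll hL' ?_ (fun i => ?_) (fun i => ?_)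
      (fun i => ?_) <;> rw [abs_sub_comm]
    exacts [ha, hm i, hp i, hk i]

end QP
-- Piecewise continuous functions of time
section PiecewiseContinuous

variable {F G : Type*}

theorem PiecewiseContinuous.prodMk [TopologicalSpace F] [TopologicalSpace G] {f : ℝ → F}
    {g : ℝ → G} (hf : PiecewiseContinuous f) (hg : PiecewiseContinuous g) :
    PiecewiseContinuous fun t => (f t, g t) := by
  classical
  refine ⟨fun T => ?_, fun t ht => ?_, fun t ht => ?_⟩
  · obtain ⟨D₁, h₁⟩ := hf.1 T
    obtain ⟨D₂, h₂⟩ := hg.1 T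
    refine ⟨D₁ ∪ D₂, fun t ht htD => ?_⟩
    rw [Finset.mem_union, not_or] at htD
    exact (h₁ t ht htD.1).prodMk (h₂ t ht htD.2)
  · obtain ⟨l₁, h₁⟩ := hf.2.1 t ht
    obtain ⟨l₂, h₂⟩ := hg.2.1 t ht
    exact ⟨_, h₁.prodMk_nhds h₂⟩
  · obtain ⟨l₁, h₁⟩ := hf.2.2 t ht
    obtain ⟨l₂, h₂⟩ := hg.2.2 t ht
    exact ⟨_, h₁.prodMk_nhds h₂⟩

theorem PiecewiseContinuous.pi {ι : Type*} [Fintype ι] [TopologicalSpace F] {f : ι → ℝ → F}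
    (hf : ∀ i, PiecewiseContinuous (f i)) : PiecewiseContinuous fun t i => f i t := by
  classical
  refine ⟨fun T => ?_, fun t ht => ?_, fun t ht => ?_⟩
  · choose D hD using fun i => (hf i).1 T
    refine ⟨Finset.univ.biUnion D, fun t ht htD => continuousWithinAt_pi.2 fun i => hD i t ht ?_⟩
    exact fun h => htD (Finset.mem_biUnion.2 ⟨i, Finset.mem_univ i, h⟩)
  · choose l hl using fun i => (hf i).2.1 t ht
    exact ⟨l, tendsto_pi_nhds.2 hl⟩
  · choose l hl using fun i => (hf i).2.2 t ht
    exact ⟨l, tendsto_pi_nhds.2 hl⟩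

theorem PiecewiseContinuous.isBounded_image [PseudoMetricSpace F] {f : ℝ → F}
    (hf : PiecewiseContinuous f) (T : ℝ) : Bornology.IsBounded (f '' Icc 0 T) := by
  -- A one-sided limit ignores the value at `t`, hence the insertion of `t`.
  have key : ∀ (s : Set ℝ) (t : ℝ) (l : F), Tendsto f (𝓝[s] t) (𝓝 l) →
      ∃ V ∈ 𝓝[insert t s] t, Bornology.IsBounded (f '' V) := fun s t l hl => by
    refine ⟨insert t (f ⁻¹' Metric.ball l 1),
      insert_mem_nhdsWithin_insert (hl (Metric.ball_mem_nhds l one_pos)), ?_⟩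
    rw [image_insert_eq, Bornology.isBounded_insert]
    exact Metric.isBounded_ball.subset (image_preimage_subset _ _)
  refine isCompact_Icc.induction_on (p := fun s => Bornology.IsBounded (f '' s)) ?_ ?_ ?_ ?_
  · simp
  · exact fun s t hst ht => ht.subset (image_mono hst)
  · intro s t hs ht
    rw [image_union]
    exact hs.union ht
  · intro t ht
    obtain ⟨l₁, h₁⟩ := hf.2.1 t ht.1
    obtain ⟨V₁, hV₁, hb₁⟩ := key _ t l₁ h₁
    rw [Ioi_insert] at hV₁
    rcases ht.1.eq_or_lt with h0 | h0
    · subst h0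
      exact ⟨V₁, nhdsWithin_mono _ Icc_subset_Ici_self hV₁, hb₁⟩
    · obtain ⟨l₂, h₂⟩ := hf.2.2 t h0
      obtain ⟨V₂, hV₂, hb₂⟩ := key _ t l₂ h₂
      rw [Iio_insert] at hV₂
      refine ⟨V₂ ∪ V₁, mem_nhdsWithin_of_mem_nhds ?_, by rw [image_union]; exact hb₂.union hb₁⟩
      rw [← nhdsLE_sup_nhdsGE]
      exact union_mem_sup hV₂ hV₁

theorem exists_tendsto_of_dist_le {α : Type*} [PseudoMetricSpace F] [PseudoMetricSpace G]
    [CompleteSpace G] {l : Filter α} [l.NeBot] {p : α → G} {q : α → F} {C : ℝ} {A : Set α}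
    (hq : ∃ y, Tendsto q l (𝓝 y)) (hA : A ∈ l)
    (h : ∀ s ∈ A, ∀ t ∈ A, dist (p s) (p t) ≤ C * dist (q s) (q t)) :
    ∃ y, Tendsto p l (𝓝 y) := by
  obtain ⟨y, hy⟩ := hq
  have h1 := (cauchy_map_iff.1 hy.cauchy_map).2
  rw [tendsto_uniformity_iff_dist_tendsto_zero] at h1
  refine cauchy_map_iff_exists_tendsto.1 (cauchy_map_iff.2 ⟨inferInstance, ?_⟩)
  rw [tendsto_uniformity_iff_dist_tendsto_zero]
  refine squeeze_zero' (Eventually.of_forall fun _ => dist_nonneg) ?_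
    (by simpa using h1.const_mul C)
  filter_upwards [prod_mem_prod hA hA] with x hx
  exact h _ hx.1 _ hx.2

/-- Continuity points carry over directly. One-sided limits carry over by the Cauchy criterion,
which is why completeness is needed. -/
theorem PiecewiseContinuous.of_dist_le [PseudoMetricSpace F] [PseudoMetricSpace G]
    [CompleteSpace G] {p : ℝ → G} {q : ℝ → F} (hq : PiecewiseContinuous q)
    (h : ∀ T : ℝ, ∃ C : ℝ, ∀ s ∈ Icc 0 T, ∀ t ∈ Icc 0 T,
      dist (p s) (p t) ≤ C * dist (q s) (q t)) :
    PiecewiseContinuous p := by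
  refine ⟨fun T => ?_, fun t ht => ?_, fun t ht => ?_⟩
  · obtain ⟨D, hD⟩ := hq.1 T
    -- Continuity within `[0, ∞)` at `t = T` involves times beyond `T`.
    obtain ⟨C, hC⟩ := h (T + 1)
    refine ⟨D, fun t ht htD => ?_⟩
    have h1 := tendsto_iff_dist_tendsto_zero.1 (hD t ht htD)
    refine tendsto_iff_dist_tendsto_zero.2
      (squeeze_zero' (Eventually.of_forall fun _ => dist_nonneg) ?_
        (by simpa using h1.const_mul C))
    filter_upwards [self_mem_nhdsWithin,
      mem_nhdsWithin_of_mem_nhds (Iic_mem_nhds (show t < T + 1 by linarith [ht.2]))] with s hs hs'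
    exact hC s ⟨hs, hs'⟩ t ⟨ht.1, by linarith [ht.2]⟩
  · obtain ⟨C, hC⟩ := h (t + 1)
    refine exists_tendsto_of_dist_le (hq.2.1 t ht) ?_ hC
    filter_upwards [Ioo_mem_nhdsGT (lt_add_one t)] with s hs
    exact ⟨ht.trans hs.1.le, hs.2.le⟩
  · obtain ⟨C, hC⟩ := h t
    refine exists_tendsto_of_dist_le (hq.2.2 t ht) ?_ hC
    filter_upwards [Ioo_mem_nhdsLT ht] with s hs
    exact ⟨hs.1.le, hs.2.le⟩

end PiecewiseContinuous

/-! ### Functions regular in time and state -/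

section LipschitzInState

variable {n : ℕ} {F G : Type*} {E : Set (Vec n)}

theorem LipschitzInState.prodMk [PseudoEMetricSpace F] [PseudoEMetricSpace G]
    {f : ℝ → Vec n → F} {g : ℝ → Vec n → G} (hf : LipschitzInState E f)
    (hg : LipschitzInState E g) : LipschitzInState E fun t z => (f t z, g t z) := by
  intro T z₀ hz₀
  obtain ⟨K₁, U₁, hU₁, h₁⟩ := hf T z₀ hz₀
  obtain ⟨K₂, U₂, hU₂, h₂⟩ := hg T z₀ hz₀
  exact ⟨max K₁ K₂, U₁ ∩ U₂, inter_mem hU₁ hU₂, fun t ht =>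
    ((h₁ t ht).mono inter_subset_left).prodMk ((h₂ t ht).mono inter_subset_right)⟩

theorem LipschitzInState.pi {ι : Type*} [Fintype ι] [PseudoEMetricSpace F]
    {f : ι → ℝ → Vec n → F} (hf : ∀ i, LipschitzInState E (f i)) :
    LipschitzInState E fun t z i => f i t z := by
  intro T z₀ hz₀
  choose K U hU h using fun i => hf i T z₀ hz₀
  refine ⟨Finset.univ.sup K, ⋂ i, U i, iInter_mem.2 hU, fun t ht z hz z' hz' => ?_⟩
  refine edist_pi_le_iff.2 fun i => (h i t ht (mem_iInter.1 hz i) (mem_iInter.1 hz' i)).trans ?_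
  gcongr
  exact Finset.le_sup (Finset.mem_univ i)

theorem PiecewiseContLipschitz.prodMk [PseudoEMetricSpace F] [PseudoEMetricSpace G]
    {f : ℝ → Vec n → F} {g : ℝ → Vec n → G} (hf : PiecewiseContLipschitz E f)
    (hg : PiecewiseContLipschitz E g) : PiecewiseContLipschitz E fun t z => (f t z, g t z) :=
  ⟨fun z hz => (hf.1 z hz).prodMk (hg.1 z hz), hf.2.prodMk hg.2⟩

theorem PiecewiseContLipschitz.pi {ι : Type*} [Fintype ι] [PseudoEMetricSpace F]
    {f : ι → ℝ → Vec n → F} (hf : ∀ i, PiecewiseContLipschitz E (f i)) :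
    PiecewiseContLipschitz E fun t z i => f i t z :=
  ⟨fun z hz => PiecewiseContinuous.pi fun i => (hf i).1 z hz, LipschitzInState.pi fun i => (hf i).2⟩

/-- One estimate with both time and state varying serves twice: `z = z'` gives the behaviour in
time, `s = t` the Lipschitz bound. -/
theorem PiecewiseContLipschitz.of_dist_le [PseudoMetricSpace F] [PseudoMetricSpace G]
    [CompleteSpace G] {p : ℝ → Vec n → G} {q : ℝ → Vec n → F} (hq : PiecewiseContLipschitz E q)
    (h : ∀ T : ℝ, ∀ z₀ ∈ E, ∃ C : ℝ, ∃ U ∈ 𝓝[E] z₀, ∀ s ∈ Icc 0 T, ∀ t ∈ Icc 0 T,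
      ∀ z ∈ U, ∀ z' ∈ U, dist (p s z) (p t z') ≤ C * dist (q s z) (q t z')) :
    PiecewiseContLipschitz E p := by
  refine ⟨fun z hz => (hq.1 z hz).of_dist_le fun T => ?_, fun T z hz => ?_⟩
  · obtain ⟨C, U, hU, hC⟩ := h T z hz
    have hzU := mem_of_mem_nhdsWithin hz hU
    exact ⟨C, fun s hs t ht => hC s hs t ht z hzU z hzU⟩
  · obtain ⟨C, U, hU, hC⟩ := h T z hz
    obtain ⟨K, V, hV, hK⟩ := hq.2 T z hz
    refine ⟨C.toNNReal * K, U ∩ V, inter_mem hU hV, fun t ht =>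
      LipschitzOnWith.of_dist_le_mul fun x hx y hy => ?_⟩
    have h2 := (hK t ht).dist_le_mul x hx.2 y hy.2
    calc dist (p t x) (p t y) ≤ C * dist (q t x) (q t y) := hC t ht t ht x hx.1 y hy.1
      _ ≤ C.toNNReal * dist (q t x) (q t y) := by gcongr; exact Real.le_coe_toNNReal C
      _ ≤ C.toNNReal * (K * dist x y) := by gcongr
      _ = _ := by push_cast; ring

theorem PiecewiseContLipschitz.locally_bounded [SeminormedAddCommGroup F] {q : ℝ → Vec n → F}
    (hq : PiecewiseContLipschitz E q) (T : ℝ) {z₀ : Vec n} (hz₀ : z₀ ∈ E) :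
    ∃ B : ℝ, ∃ U ∈ 𝓝[E] z₀, ∀ t ∈ Icc 0 T, ∀ z ∈ U, ‖q t z‖ ≤ B := by
  obtain ⟨B, hB⟩ := ((hq.1 z₀ hz₀).isBounded_image T).exists_norm_le
  obtain ⟨K, U, hU, hK⟩ := hq.2 T z₀ hz₀
  refine ⟨B + K * 1, U ∩ Metric.ball z₀ 1,
    inter_mem hU (mem_nhdsWithin_of_mem_nhds (Metric.ball_mem_nhds _ one_pos)),
    fun t ht z hz => ?_⟩
  have h1 := (hK t ht).dist_le_mul z hz.1 z₀ (mem_of_mem_nhdsWithin hz₀ hU)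
  have h2 : (K : ℝ) * dist z z₀ ≤ K * 1 := by gcongr; exact (Metric.mem_ball.1 hz.2).le
  have h3 := hB _ (mem_image_of_mem _ ht)
  rw [dist_eq_norm] at h1
  have h4 := norm_le_norm_add_norm_sub' (q t z) (q t z₀)
  linarith

theorem NonzeroValuesAwayFromZero.finite {ι : Type*} [Finite ι] {b : ι → ℝ → Vec n → ℝ}
    (hb : ∀ i, NonzeroValuesAwayFromZero E (b i)) (T : ℝ) {z₀ : Vec n} (hz₀ : z₀ ∈ E) :
    ∃ ε > 0, ∃ U ∈ 𝓝[E] z₀, ∀ i, ∀ t ∈ Icc 0 T, ∀ z ∈ U, b i t z = 0 ∨ ε ≤ |b i t z| := by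
  choose ε hε U hU h using fun i => hb i T z₀ hz₀
  have h1 : ∀ᶠ δ in 𝓝[>] (0 : ℝ), ∀ i, δ ∈ Ioc 0 (ε i) :=
    eventually_all.2 fun i => Ioc_mem_nhdsGT (hε i)
  obtain ⟨δ, hδ, hδ0⟩ := (h1.and self_mem_nhdsWithin).exists
  exact ⟨δ, hδ0, ⋂ i, U i, iInter_mem.2 hU, fun i t ht z hz =>
    (h i t ht z (mem_iInter.1 hz i)).imp_right (hδ i).2.trans⟩

/-- The Lipschitz constant is uniform in time, so `z s` may be replaced by the frozen state `z t`,
where piecewise continuity applies. -/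
theorem PiecewiseContLipschitz.exists_tendsto_comp [PseudoMetricSpace F] {p : ℝ → Vec n → F}
    (hp : PiecewiseContLipschitz E p) {z : ℝ → Vec n} {t : ℝ} (ht : 0 ≤ t) (hzt : z t ∈ E)
    (hz : Tendsto z (𝓝[>] t) (𝓝[E] (z t))) :
    ∃ y, Tendsto (fun s => p s (z s)) (𝓝[>] t) (𝓝 y) := by
  obtain ⟨y, hy⟩ := (hp.1 _ hzt).2.1 t ht
  obtain ⟨K, U, hU, hK⟩ := hp.2 (t + 1) _ hzt
  refine ⟨y, tendsto_iff_dist_tendsto_zero.2 ?_⟩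
  have h1 := (tendsto_iff_dist_tendsto_zero.1 (hz.mono_right nhdsWithin_le_nhds)).const_mul (K : ℝ)
  have h2 := h1.add (tendsto_iff_dist_tendsto_zero.1 hy)
  rw [mul_zero, add_zero] at h2
  refine squeeze_zero' (Eventually.of_forall fun _ => dist_nonneg) ?_ h2
  filter_upwards [Ioo_mem_nhdsGT (lt_add_one t), hz hU] with s hs hsU
  exact (dist_triangle _ (p s (z t)) _).trans (add_le_add_left
    ((hK s ⟨ht.trans hs.1.le, hs.2.le⟩).dist_le_mul _ hsU _ (mem_of_mem_nhdsWithin hzt hU)) _)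

end LipschitzInState

/-! ### Regularity of the controller -/

section Controller

variable {n m ny nd nv : ℕ} {sys : ControlSystem n m ny nd nv} {E : Set (Vec n)}
  {P : ℝ → Vec n → Set (Vec n)} {h : Vec n → ℝ} {α κ : ℝ → ℝ} {wbar : ℝ}
  {a : ℝ → Vec n → ℝ} {bm bp : Fin m → ℝ → Vec n → ℝ} {πdes π : ℝ → Vec n → Vec m}

theorem lieG_apply (x : Vec n) (u : Vec m) :
    lieG sys h x u = ∑ i, lieGComp sys h x i * u i := by
  have hu : u = ∑ i, u i • EuclideanSpace.single i (1 : ℝ) := by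
    ext j; simp [Pi.single_apply]
  conv_lhs => rw [hu]
  rw [map_sum]
  exact Finset.sum_congr rfl fun i _ => by
    rw [map_smul, smul_eq_mul, mul_comm]; rfl

/-- If every lower bound vanished, equality of signs would make the upper bounds vanish too, forcing
`L_g h = 0` on all of `P t z`. -/
theorem IsGainBound.exists_ne_zero (hb : IsGainBound sys E P h bm bp) {t : ℝ} (ht : 0 ≤ t)
    {z : Vec n} (hz : z ∈ E) : ∃ i, bm i t z ≠ 0 := by
  obtain ⟨x, hx, hne⟩ := hb.relDegOne t ht z hz
  by_contra! hcon
  refine hne (ContinuousLinearMap.ext fun u => ?_)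
  rw [lieG_apply, zero_apply]
  refine Finset.sum_eq_zero fun i _ => ?_
  have h1 := hb.sign_eq i t ht z hz
  rw [hcon i, sign_zero, eq_comm, sign_eq_zero_iff] at h1
  have h2 := hb.bounds i t ht z hz x hx
  rw [hcon i, h1] at h2
  rw [le_antisymm h2.2 h2.1, zero_mul]

theorem IsGainBound.locally_qpBounds (hb : IsGainBound sys E P h bm bp)
    (ha : PiecewiseContLipschitz E a) (hπdes : PiecewiseContLipschitz E πdes) (T : ℝ)
    {z₀ : Vec n} (hz₀ : z₀ ∈ E) :
    ∃ B ε : ℝ, ∃ U ∈ 𝓝[E] z₀, ∀ t ∈ Icc 0 T, ∀ z ∈ U, z ∈ E ∧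
      QPBounds B ε (a t z) (fun i => bm i t z) (fun i => bp i t z) (πdes t z) := by
  obtain ⟨B, U, hU, hB⟩ := (ha.prodMk ((PiecewiseContLipschitz.pi hb.regular_m).prodMk
    ((PiecewiseContLipschitz.pi hb.regular_p).prodMk hπdes))).locally_bounded T hz₀
  obtain ⟨ε₁, hε₁, V₁, hV₁, h₁⟩ := NonzeroValuesAwayFromZero.finite hb.away_m T hz₀
  obtain ⟨ε₂, hε₂, V₂, hV₂, h₂⟩ := NonzeroValuesAwayFromZero.finite hb.away_p T hz₀
  refine ⟨B, min ε₁ ε₂, U ∩ (V₁ ∩ (V₂ ∩ E)), inter_mem hU (inter_mem hV₁ (inter_mem hV₂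
    self_mem_nhdsWithin)), fun t ht z hz => ⟨hz.2.2.2, ?_⟩⟩
  have hzB := hB t ht z hz.1
  simp only [Prod.norm_mk, sup_le_iff] at hzB
  obtain ⟨hBa, hBm, hBp, hBk⟩ := hzB
  refine ⟨lt_min hε₁ hε₂, hBa, fun i => (norm_le_pi_norm (fun i => bm i t z) i).trans hBm,
    fun i => (norm_le_pi_norm (fun i => bp i t z) i).trans hBp,
    fun i => (PiLp.norm_apply_le _ i).trans hBk, fun i => ?_,
    hb.exists_ne_zero ht.1 hz.2.2.2⟩
  -- A point of `P t z` is needed to know that the lower bound does not exceed the upper one.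
  obtain ⟨x, hx, -⟩ := hb.relDegOne t ht.1 z hz.2.2.2
  have hle := hb.bounds i t ht.1 z hz.2.2.2 x hx
  exact GainPair.of_sign_eq (hle.1.trans hle.2) (hb.sign_eq i t ht.1 z hz.2.2.2)
    ((h₁ i t ht z hz.2.1).imp_right (min_le_left _ _).trans)
    ((h₂ i t ht z hz.2.2.1).imp_right (min_le_right _ _).trans)

theorem IsGainBound.existsUnique_qpSolution (hb : IsGainBound sys E P h bm bp)
    (ha : PiecewiseContLipschitz E a) (hπdes : PiecewiseContLipschitz E πdes) {t : ℝ}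
    (ht : 0 ≤ t) {z : Vec n} (hz : z ∈ E) :
    ∃! u : Vec m,
      IsQPSolution (a t z) (fun i => bm i t z) (fun i => bp i t z) (πdes t z) u := by
  obtain ⟨B, ε, U, hU, hQ⟩ := hb.locally_qpBounds ha hπdes t hz
  exact (hQ t ⟨ht, le_rfl⟩ z (mem_of_mem_nhdsWithin hz hU)).2.existsUnique

theorem IsQPController.piecewiseContLipschitz (hπ : IsQPController E a bm bp πdes π)
    (hb : IsGainBound sys E P h bm bp)
    (ha : PiecewiseContLipschitz E a) (hπdes : PiecewiseContLipschitz E πdes) :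
    PiecewiseContLipschitz E π := by
  refine (ha.prodMk ((PiecewiseContLipschitz.pi hb.regular_m).prodMk
    ((PiecewiseContLipschitz.pi hb.regular_p).prodMk hπdes))).of_dist_le fun T z₀ hz₀ => ?_
  obtain ⟨B, ε, U, hU, hQ⟩ := hb.locally_qpBounds ha hπdes T hz₀
  refine ⟨qpLip m B ε, U, hU, fun s hs t ht z hz z' hz' => ?_⟩
  obtain ⟨hzE, hB⟩ := hQ s hs z hz
  obtain ⟨hzE', hB'⟩ := hQ t ht z' hz'
  rw [dist_eq_norm]
  -- The product carries the sup metric, so the distance of the data tuples dominates that of every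
  -- component.
  obtain ⟨da, dm, dp, dk⟩ : dist (a s z) (a t z') ≤ dist (a s z, (fun i => bm i s z),
      (fun i => bp i s z), πdes s z) (a t z', (fun i => bm i t z'), (fun i => bp i t z'),
      πdes t z') ∧ _ ∧ _ ∧ _ := by
    have := le_refl (dist (a s z, (fun i => bm i s z), (fun i => bp i s z), πdes s z)
      (a t z', (fun i => bm i t z'), (fun i => bp i t z'), πdes t z'))
    nth_rw 1 [Prod.dist_eq, Prod.dist_eq, Prod.dist_eq] at this
    simp only [sup_le_iff] at this
    exact this
  refine hB.norm_solution_sub_le hB' (hπ s hs.1 z hzE) (hπ t ht.1 z' hzE') da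
    (fun i => (dist_le_pi_dist (fun i => bm i s z) (fun i => bm i t z') i).trans dm)
    (fun i => (dist_le_pi_dist (fun i => bp i s z) (fun i => bp i t z') i).trans dp)
    (fun i => le_trans ?_ dk)
  rw [dist_eq_norm]
  exact PiLp.norm_apply_le (πdes s z - πdes t z') i

end Controller
-- Right derivatives along trajectories and invariance of the safe set
section Safety

variable {n m ny nd nv : ℕ} {sys : ControlSystem n m ny nd nv} {obs : Observer sys}
  {E : Set (Vec n)} {P : ℝ → Vec n → Set (Vec n)} {h : Vec n → ℝ} {α κ : ℝ → ℝ} {wbar : ℝ}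
  {a : ℝ → Vec n → ℝ} {bm bp : Fin m → ℝ → Vec n → ℝ} {πdes π : ℝ → Vec n → Vec m}
  {T : ℝ} {x xh : ℝ → Vec n}

theorem tendsto_continuousLinearMap_apply {ι V W : Type*} [NormedAddCommGroup V] [NormedSpace ℝ V]
    [NormedAddCommGroup W] [NormedSpace ℝ W] {l : Filter ι} {A : ι → V →L[ℝ] W} {v : ι → V}
    {A₀ : V →L[ℝ] W} {v₀ : V} (hA : Tendsto A l (𝓝 A₀)) (hv : Tendsto v l (𝓝 v₀)) :
    Tendsto (fun i => A i (v i)) l (𝓝 (A₀ v₀)) :=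
  (isBoundedBilinearMap_apply.continuous.tendsto (A₀, v₀)).comp (hA.prodMk_nhds hv)

theorem tendsto_nhdsGT_of_continuousOn_Ico {F : Type*} [TopologicalSpace F] {y : ℝ → F}
    (hy : ContinuousOn y (Ico 0 T)) {t : ℝ} (ht : t ∈ Ico 0 T) :
    Tendsto y (𝓝[>] t) (𝓝 (y t)) := by
  refine (hy t ht).mono_left (nhdsWithin_le_iff.2 ?_)
  filter_upwards [Ioo_mem_nhdsGT ht.2] with s hs
  exact ⟨ht.1.trans hs.1.le, hs.2⟩

theorem IsClosedLoopSolution.exists_tendsto_stateField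
    (hsol : IsClosedLoopSolution obs E π T x xh) (hπ : PiecewiseContLipschitz E π) {t : ℝ}
    (ht : t ∈ Ico 0 T) :
    ∃ L, Tendsto (fun s => sys.stateField s (x s) (π s (xh s))) (𝓝[>] t) (𝓝 L) := by
  have hx := tendsto_nhdsGT_of_continuousOn_Ico hsol.state_cont ht
  have hX : sys.X ∈ 𝓝 (x t) := sys.isOpen_X.mem_nhds (hsol.state_mem t ht)
  have hxh : Tendsto xh (𝓝[>] t) (𝓝[E] (xh t)) := by
    refine tendsto_nhdsWithin_iff.2
      ⟨tendsto_nhdsGT_of_continuousOn_Ico hsol.estimate_cont ht, ?_⟩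
    filter_upwards [Ioo_mem_nhdsGT ht.2] with s hs
    exact hsol.estimate_mem s ⟨ht.1.trans hs.1.le, hs.2⟩
  obtain ⟨u, hu⟩ := hπ.exists_tendsto_comp ht.1 (hsol.estimate_mem t ht) hxh
  obtain ⟨w, hw⟩ := sys.d_pc.2.1 t ht.1
  have hf := (sys.f_lip.continuousOn.continuousAt hX).tendsto.comp hx
  have hg := (sys.g_lip.continuousOn.continuousAt hX).tendsto.comp hx
  have hgd := (sys.gd_lip.continuousOn.continuousAt hX).tendsto.comp hx
  exact ⟨_, (hf.add (tendsto_continuousLinearMap_apply hg hu)).add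
    (tendsto_continuousLinearMap_apply hgd hw)⟩

/-- The integral equation gives a right derivative equal to the right limit `L` of the velocity,
even at jump times, where `L` may differ from the field's value. -/
theorem IsClosedLoopSolution.hasDerivWithinAt_state
    (hsol : IsClosedLoopSolution obs E π T x xh) {t : ℝ} (ht : t ∈ Ico 0 T) {L : Vec n}
    (hL : Tendsto (fun s => sys.stateField s (x s) (π s (xh s))) (𝓝[>] t) (𝓝 L)) :
    HasDerivWithinAt x L (Ici t) t := by
  obtain ⟨t', htt', ht'T⟩ := exists_between ht.2
  have hint := hsol.state_integrable t' ⟨ht.1.trans htt'.le, ht'T⟩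
  have hmeas : StronglyMeasurableAtFilter
      (fun s => sys.stateField s (x s) (π s (xh s))) (𝓝[>] t) volume := by
    refine ⟨Ioc 0 t', ?_, hint.1.aestronglyMeasurable⟩
    filter_upwards [Ioo_mem_nhdsGT htt'] with s hs
    exact ⟨ht.1.trans_lt hs.1, hs.2.le⟩
  have hd := (intervalIntegral.integral_hasDerivWithinAt_of_tendsto_ae_right
    (s := Ici t) (t := Ioi t) (hsol.state_integrable t ht) hmeas
    (hL.mono_left inf_le_left)).const_add (x 0)
  refine hd.congr_of_eventuallyEq ?_ (hsol.state_eq t ht)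
  filter_upwards [Ico_mem_nhdsGE ht.2] with s hs
  exact hsol.state_eq s ⟨ht.1.trans hs.1, hs.2⟩

theorem ControlSystem.zero_le_dbar (sys : ControlSystem n m ny nd nv) : 0 ≤ sys.dbar :=
  (norm_nonneg _).trans (sys.d_bound 0 le_rfl)

theorem ContDiffOn.continuousAt_fderiv_of_isOpen {X : Set (Vec n)} (hX : IsOpen X)
    (hh : ContDiffOn ℝ 1 h X) {y : Vec n} (hy : y ∈ X) : ContinuousAt (fderiv ℝ h) y :=
  (hh.continuousOn_fderiv_of_isOpen hX le_rfl).continuousAt (hX.mem_nhds hy)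

/-- Where the barrier function is negative, the safe controller does not decrease it. -/
theorem fderiv_stateField_nonneg (hα : IsClassK α) (hκ : IsTuning κ) (hw : sys.dbar ≤ wbar)
    (ha : IsDriftBound sys E P h α κ wbar a) (hb : IsGainBound sys E P h bm bp)
    {t : ℝ} (ht : 0 ≤ t) {z : Vec n} (hz : z ∈ E) {y : Vec n} (hy : y ∈ P t z) (hneg : h y < 0)
    {u : Vec m} (hu : u ∈ qpFeasible (a t z) (fun i => bm i t z) (fun i => bp i t z)) :
    0 ≤ fderiv ℝ h y (sys.stateField t y u) := by
  have hu' : 0 ≤ a t z + ∑ i, min (bm i t z * u i) (bp i t z * u i) := hu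
  -- Each minimum is the worst case of `[L_g h]_i u_i` over gains in the allowed interval.
  have h1 : ∑ i, min (bm i t z * u i) (bp i t z * u i) ≤ lieG sys h y u := by
    rw [lieG_apply]
    refine Finset.sum_le_sum fun i _ => ?_
    obtain ⟨hl, hr⟩ := hb.bounds i t ht z hz y hy
    rcases le_total 0 (u i) with h0 | h0
    · exact (min_le_left _ _).trans (mul_le_mul_of_nonneg_right hl h0)
    · exact (min_le_right _ _).trans (mul_le_mul_of_nonpos_right hr h0)
  have h2 := ha.lower t ht z hz y hy
  have h3 : α (h y) ≤ 0 := hα.zero ▸ hα.mono hneg.le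
  have h4 : 1 ≤ κ (h y) := hκ.zero ▸ hκ.anti hneg.le
  have h5 : -(‖lieGd sys h y‖ * sys.dbar) ≤ lieGd sys h y (sys.d t) := by
    refine (neg_le_neg ?_).trans (neg_abs_le _)
    exact ((lieGd sys h y).le_opNorm _).trans
      (mul_le_mul_of_nonneg_left (sys.d_bound t ht) (norm_nonneg _))
  have h6 : ‖lieGd sys h y‖ * sys.dbar ≤ κ (h y) * ‖lieGd sys h y‖ * wbar :=
    mul_le_mul (le_mul_of_one_le_left (norm_nonneg _) h4) hw sys.zero_le_dbar
      (mul_nonneg (zero_le_one.trans h4) (norm_nonneg _))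
  have h7 : fderiv ℝ h y (sys.stateField t y u) =
      lieF sys h y + lieG sys h y u + lieGd sys h y (sys.d t) := by
    simp [ControlSystem.stateField, lieF, lieG, lieGd]
  rw [h7]
  linarith

theorem IsClosedLoopSolution.mem_safeSet (hsol : IsClosedLoopSolution obs E π T x xh)
    (hπ : PiecewiseContLipschitz E π) (hh : ContDiffOn ℝ 1 h sys.X)
    (hnonneg : ∀ t ∈ Ico 0 T, h (x t) < 0 →
      0 ≤ fderiv ℝ h (x t) (sys.stateField t (x t) (π t (xh t))))
    (h0 : 0 ≤ h (x 0)) {t₁ : ℝ} (ht₁ : t₁ ∈ Ico 0 T) : x t₁ ∈ safeSet sys h := by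
  refine ⟨hsol.state_mem t₁ ht₁, ?_⟩
  by_contra! hneg
  have hcont : ContinuousOn (fun t => h (x t)) (Icc 0 t₁) :=
    (hh.continuousOn.comp hsol.state_cont hsol.state_mem).mono
      fun s hs => ⟨hs.1, hs.2.trans_lt ht₁.2⟩
  -- `t₀` is the last time in `[0, t₁]` at which `h` is nonnegative.
  obtain ⟨t₀, ⟨ht₀, hht₀⟩, hmax⟩ := IsCompact.exists_isGreatest
    (isCompact_Icc.of_isClosed_subset (hcont.preimage_isClosed_of_isClosed isClosed_Icc isClosed_Ici)
      inter_subset_left) ⟨(0 : ℝ), ⟨le_rfl, ht₁.1⟩, (h0 : (0 : ℝ) ≤ h (x 0))⟩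
  have hht₀ : 0 ≤ h (x t₀) := hht₀
  have hlt : t₀ < t₁ := ht₀.2.lt_of_ne fun he => by rw [he] at hht₀; linarith
  have hneg' : ∀ s ∈ Ioc t₀ t₁, h (x s) < 0 := fun s hs => by
    by_contra! hs0
    exact absurd (hmax ⟨⟨ht₀.1.trans hs.1.le, hs.2⟩, hs0⟩) (not_le.2 hs.1)
  have hmem : ∀ s ∈ Ico t₀ t₁, s ∈ Ico 0 T := fun s hs =>
    ⟨ht₀.1.trans hs.1, hs.2.trans ht₁.2⟩
  have hlim : ∀ s : ℝ, ∃ L, s ∈ Ico t₀ t₁ →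
      Tendsto (fun r => sys.stateField r (x r) (π r (xh r))) (𝓝[>] s) (𝓝 L) := fun s => by
    by_cases hs : s ∈ Ico t₀ t₁
    · obtain ⟨L, hL⟩ := hsol.exists_tendsto_stateField hπ (hmem s hs)
      exact ⟨L, fun _ => hL⟩
    · exact ⟨0, fun h => absurd h hs⟩
  choose L hL using hlim
  have hderiv : ∀ s ∈ Ico t₀ t₁, HasDerivWithinAt (fun r => -h (x r))
      (-(fderiv ℝ h (x s) (L s))) (Ici s) s := fun s hs => by
    have hd : HasFDerivAt h (fderiv ℝ h (x s)) (x s) :=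
      ((hh.contDiffAt (sys.isOpen_X.mem_nhds (hsol.state_mem s (hmem s hs)))).differentiableAt
        one_ne_zero).hasFDerivAt
    exact (hd.comp_hasDerivWithinAt s
      (hsol.hasDerivWithinAt_state (hmem s hs) (hL s hs))).neg
  -- The sign is obtained as a limit from times `r > s`: at `s = t₀` the function `h` is not
  -- negative, and at jumps `L s` need not be the field's value.
  have hge : ∀ s ∈ Ico t₀ t₁, -(fderiv ℝ h (x s) (L s)) ≤ 0 := fun s hs => by
    have hx := tendsto_nhdsGT_of_continuousOn_Ico hsol.state_cont (hmem s hs)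
    have hfd := (hh.continuousAt_fderiv_of_isOpen sys.isOpen_X
      (hsol.state_mem s (hmem s hs))).tendsto.comp hx
    refine neg_nonpos.2 (ge_of_tendsto (tendsto_continuousLinearMap_apply hfd (hL s hs)) ?_)
    filter_upwards [Ioo_mem_nhdsGT hs.2] with r hr
    exact hnonneg r (hmem r ⟨hs.1.trans hr.1.le, hr.2⟩) (hneg' r ⟨hs.1.trans_lt hr.1, hr.2.le⟩)
  have := image_le_of_deriv_right_le_deriv_boundary (B := fun _ => -h (x t₀)) (B' := fun _ => 0)
    ((hcont.mono (Icc_subset_Icc_left ht₀.1)).neg) hderiv le_rfl continuousOn_const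
    (fun s _ => hasDerivWithinAt_const _ _ _) hge ⟨hlt.le, le_rfl⟩
  have : -h (x t₁) ≤ -h (x t₀) := this
  linarith

end Safety

theorem theorem3 {n m ny nd nv : ℕ} (sys : ControlSystem n m ny nd nv) (obs : Observer sys)
    (E : Set (Vec n)) (hE : E ⊆ sys.X)
    (D : Vec n → Set (Vec n)) (P : ℝ → Vec n → Set (Vec n))
    (h : Vec n → ℝ) (α κ : ℝ → ℝ) (hcbf : IsTRCBF sys univ h α κ)
    (wbar : ℝ) (hw : sys.dbar ≤ wbar)
    (a : ℝ → Vec n → ℝ) (ha : IsDriftBound sys E P h α κ wbar a)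
    (bm bp : Fin m → ℝ → Vec n → ℝ) (hb : IsGainBound sys E P h bm bp)
    (πdes : ℝ → Vec n → Vec m) (hπdes : PiecewiseContLipschitz E πdes)
    (hBE : ∀ π : ℝ → Vec n → Vec m, IsQPController E a bm bp πdes π →
      IsBoundedErrorObserver obs E π D P) :
    (∀ t : ℝ, 0 ≤ t → ∀ z ∈ E, ∃! u : Vec m,
      IsQPSolution (a t z) (fun i => bm i t z) (fun i => bp i t z) (πdes t z) u) ∧
    ∀ π : ℝ → Vec n → Vec m, IsQPController E a bm bp πdes π →
      PiecewiseContLipschitz E π ∧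
      RendersSafe obs E π (safeSet sys h) D {z | z ∈ E ∧ P 0 z ⊆ safeSet sys h} := by
  refine ⟨fun t ht z hz => hb.existsUnique_qpSolution ha.regular hπdes ht hz, fun π hπ => ?_⟩
  have hreg := hπ.piecewiseContLipschitz hb ha.regular hπdes
  refine ⟨hreg, fun T x xh hsol hxh hx t ht => ?_⟩
  have hP := (hBE π hπ).error_bound T x xh hsol hx
  -- Initial safety follows from the error bound at time `0`, which places `x 0` in `P 0 (xh 0)`.
  refine hsol.mem_safeSet hreg hcbf.contDiff (fun s hs hneg => ?_)
    (hxh.2 (hP 0 ⟨le_rfl, ht.1.trans_lt ht.2⟩)).2 ht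
  exact fderiv_stateField_nonneg hcbf.classK hcbf.tuning hw ha hb hs.1
    (hsol.estimate_mem s hs) (hP s hs) hneg (hπ s hs.1 _ (hsol.estimate_mem s hs)).1
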